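/- A $(k,g)$-graph is a finite simple $k$-regular graph of girth $g$. For even $g$ its excess is the difference between its order and the Moore bound $M(k,g)=2\left(1+(k-1)+\dots+(k-1)^{(g-2)/2}\right)$. For a graph $G$ of girth $g=2d$, the excess graph $G(E)$ is the graph on the vertex set of $G$ in which two vertices are adjacent if and only if their distance in $G$ is $d+1$; $G$ is said to have bicyclic excess if $G(E)$ is a disjoint union of two cycles (each of length at least $3$). Theorem. Let $k\ge 7$ be odd and let $g=2d\ge 8$, where $d$ is an even integer. Then there exists no $(k,g)$-graph of excess $4$ with bicyclic excess. -/

import Mathlib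

namespace SimpleGraph

/-- The Moore bound `M(k, g)`: it is `1 + k + k(k-1) + ⋯ + k(k-1)^((g-3)/2)` for odd `g`, and
`2(1 + (k-1) + ⋯ + (k-1)^((g-2)/2))` for even `g`. -/
def mooreBound (k g : ℕ) : ℤ :=
  if Even g then 2 * ∑ i ∈ Finset.range (g / 2), ((k : ℤ) - 1) ^ i
  else 1 + ∑ i ∈ Finset.range ((g - 1) / 2), (k : ℤ) * ((k : ℤ) - 1) ^ i

/-- A `(k, g)`-graph: a `k`-regular graph of girth `g`. -/
def IsKGGraph {V : Type*} (G : SimpleGraph V) [G.LocallyFinite] (k g : ℕ) : Prop :=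
  G.IsRegularOfDegree k ∧ G.girth = g

/-- The excess of a finite graph, as a `(k, g)`-graph: its order minus the Moore bound. -/
def excess {V : Type*} [Fintype V] (_G : SimpleGraph V) (k g : ℕ) : ℤ :=
  (Fintype.card V : ℤ) - mooreBound k g

/-- The excess graph of a graph `G` of girth `2 * d`: it has the vertices of `G`, and two of them
are adjacent if and only if their distance in `G` is `d + 1`. -/
def excessGraph {V : Type*} (G : SimpleGraph V) (d : ℕ) : SimpleGraph V where
  Adj u v := G.dist u v = d + 1
  symm := ⟨fun u v h => by rw [G.dist_comm]; exact h⟩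
  loopless := ⟨fun u h => by simp at h⟩

/-- `H` is a disjoint union of two cycles (of lengths `a, b ≥ 3`). -/
def IsDisjointUnionOfTwoCycles {V : Type*} (H : SimpleGraph V) : Prop :=
  ∃ a b : ℕ, 3 ≤ a ∧ 3 ≤ b ∧ Nonempty (H ≃g (cycleGraph a ⊕g cycleGraph b))

/-- `G` (of girth `2 * d`) is a graph with bicyclic excess. -/
def HasBicyclicExcess {V : Type*} (G : SimpleGraph V) (d : ℕ) : Prop :=
  (G.excessGraph d).IsDisjointUnionOfTwoCycles

end SimpleGraph

/-! Put `q = k - 1`, an even number at least 6. The two trees hanging from an edge already account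
for the Moore bound, so at most 4 < `q` vertices lie at distance at least `d` from both its ends.
Hence G is connected with diameter at most `d + 1`. It is also bipartite
(`Connected.dist_ne_dist_of_card_farFrom_lt`): a vertex equidistant from the ends of an edge would
force at least `q` such far vertices.

Let A and E be the adjacency matrices of G and of its excess graph, K = `oddDistMatrix` and S_j =
`parityBallMatrix j`. As `d` is even, K = S_(d-1) + E. Below the girth S_j is the polynomial F_j =
`nonbacktrackingPoly` in A, and K commutes with A, so E does too. Let f be the indicator of one of
the two cycles. Then Ef = 2f gives E(Af) = 2Af, so Af is constant on each cycle: Af = af + b1 with a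
an integer. Modulo constant vectors, S_(d-1) f = F_(d-1)(a) f and Kf = 0, so F_(d-1)(a) = -2. But
`q` is even and `d - 1 ≥ 3`, so this value is odd for odd a and divisible by 4 for even a. -/

namespace SimpleGraph

/-! ### Distances below half the girth -/

section Girth

variable {V : Type*} {G : SimpleGraph V}

/-- A cycle here would be a cycle of `G` using each listed edge at most once. Short walks thus
inherit unique paths and even closed walks from forests. -/
theorem isAcyclic_fromEdgeSet_of_length_lt_girth {L : List (Sym2 V)}
    (hL : ∀ e ∈ L, e ∈ G.edgeSet) (hlt : L.length < G.girth) :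
    (fromEdgeSet {e | e ∈ L}).IsAcyclic := by
  intro v c hc
  have hle : fromEdgeSet {e | e ∈ L} ≤ G := by
    intro a b hab
    rw [fromEdgeSet_adj] at hab
    exact hL _ hab.1
  have h1 := girth_le_length ((Walk.isCycle_mapLe hle).2 hc)
  rw [Walk.length_mapLe] at h1
  have hsub : c.edges ⊆ L := by
    intro e he
    have := c.edges_subset_edgeSet he
    rw [edgeSet_fromEdgeSet] at this
    exact this.1
  have h2 := (List.subperm_of_subset hc.edges_nodup hsub).length_le
  rw [Walk.length_edges] at h2
  omega

theorem mem_edgeSet_fromEdgeSet_of_mem_edges {L : List (Sym2 V)} {u v : V} (p : G.Walk u v)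
    (h : p.edges ⊆ L) : ∀ e ∈ p.edges, e ∈ (fromEdgeSet {e | e ∈ L}).edgeSet := by
  intro e he
  rw [edgeSet_fromEdgeSet]
  exact ⟨h he, G.not_isDiag_of_mem_edgeSet (p.edges_subset_edgeSet he)⟩

theorem Walk.IsPath.eq_of_length_add_lt_girth {u v : V} {p q : G.Walk u v} (hp : p.IsPath)
    (hq : q.IsPath) (hlt : p.length + q.length < G.girth) : p = q := by
  have hac := isAcyclic_fromEdgeSet_of_length_lt_girth (G := G) (L := p.edges ++ q.edges)
    (by
      intro e he
      rcases List.mem_append.1 he with he | he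
      · exact p.edges_subset_edgeSet he
      · exact q.edges_subset_edgeSet he)
    (by simpa using hlt)
  have hp' := mem_edgeSet_fromEdgeSet_of_mem_edges p (List.subset_append_left p.edges q.edges)
  have hq' := mem_edgeSet_fromEdgeSet_of_mem_edges q (List.subset_append_right p.edges q.edges)
  have h := (hac.subsingleton_path u v).elim ⟨p.transfer _ hp', hp.transfer hp'⟩
    ⟨q.transfer _ hq', hq.transfer hq'⟩
  have h1 : p.transfer _ hp' = q.transfer _ hq' := congrArg Subtype.val h
  apply Walk.ext_support
  rw [← Walk.support_transfer p hp', h1, Walk.support_transfer]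

theorem Walk.even_length_of_length_lt_girth {u : V} (p : G.Walk u u) (hlt : p.length < G.girth) :
    Even p.length := by
  have hac := isAcyclic_fromEdgeSet_of_length_lt_girth (G := G) (L := p.edges)
    (fun e he => p.edges_subset_edgeSet he) (by simpa using hlt)
  have hp' := mem_edgeSet_fromEdgeSet_of_mem_edges p (List.Subset.refl p.edges)
  rw [← Walk.length_transfer p hp']
  exact two_colorable_iff_forall_loop_even.1 hac.colorable_two _ _

theorem Adj.dist_ne_dist_of_lt_girth {u v w : V} (h : G.Adj u v) (hr : G.Reachable u w)
    (hlt : 2 * G.dist u w + 1 < G.girth) : G.dist u w ≠ G.dist v w := by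
  intro he
  obtain ⟨p, hp⟩ := hr.exists_walk_length_eq_dist
  obtain ⟨q, hq⟩ := (h.symm.reachable.trans hr).exists_walk_length_eq_dist
  have hlen : (Walk.cons h (q.append p.reverse)).length = 2 * G.dist u w + 1 := by
    simp [hp, hq, ← he]; ring
  have := Walk.even_length_of_length_lt_girth (Walk.cons h (q.append p.reverse)) (by omega)
  rw [hlen] at this
  grind

theorem eq_of_adj_of_dist_lt_girth {u w₁ w₂ v : V} {j : ℕ} (h₁ : G.Adj u w₁) (h₂ : G.Adj u w₂)
    (hu : G.dist u v = j + 1) (hd₁ : G.dist w₁ v = j) (hd₂ : G.dist w₂ v = j)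
    (hlt : 2 * (j + 1) < G.girth) : w₁ = w₂ := by
  have hr : G.Reachable u v := Reachable.of_dist_ne_zero (by omega)
  obtain ⟨p, hp⟩ := (h₁.symm.reachable.trans hr).exists_walk_length_eq_dist
  obtain ⟨q, hq⟩ := (h₂.symm.reachable.trans hr).exists_walk_length_eq_dist
  have hp' : (Walk.cons h₁ p).length = j + 1 := by simp [hp, hd₁]
  have hq' : (Walk.cons h₂ q).length = j + 1 := by simp [hq, hd₂]
  have h := Walk.IsPath.eq_of_length_add_lt_girth
    (Walk.isPath_of_length_eq_dist _ (hp'.trans hu.symm))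
    (Walk.isPath_of_length_eq_dist _ (hq'.trans hu.symm)) (by omega)
  cases h
  rfl

theorem Adj.dist_le_dist_add_one {u v : V} (h : G.Adj u v) (w : V) :
    G.dist u w ≤ G.dist v w + 1 := by
  by_cases hr : G.Reachable v w
  · obtain ⟨p, hp⟩ := hr.exists_walk_length_eq_dist
    have := dist_le (Walk.cons h p)
    simpa [hp] using this
  · rw [dist_eq_zero_of_not_reachable fun h' => hr (h.symm.reachable.trans h')]
    omega

theorem exists_adj_dist_eq {u v : V} {j : ℕ} (h : G.dist u v = j + 1) :
    ∃ w, G.Adj u w ∧ G.dist w v = j := by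
  obtain ⟨p, hp⟩ := exists_walk_of_dist_ne_zero (G := G) (u := u) (v := v) (by omega)
  cases p with
  | nil => simp at h
  | cons hadj q =>
    refine ⟨_, hadj, ?_⟩
    have h1 := dist_le q
    have h2 := hadj.dist_le_dist_add_one v
    simp at hp
    omega

end Girth

/-! ### The Moore bound around an edge, and connectedness -/

section Counting

variable {V : Type*} [Fintype V] {G : SimpleGraph V}

open Classical in
/-- The vertices at distance `i` from `x` and `i + 1` from its neighbour `y`. -/
noncomputable def edgeLevel (G : SimpleGraph V) (x y : V) (i : ℕ) : Finset V :=
  {w | G.Reachable w x ∧ G.dist w x = i ∧ G.dist w y = i + 1}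

open Classical in
/-- The vertices at distance less than `m` from `x` that are closer to `x` than to `y`. -/
noncomputable def edgeBall (G : SimpleGraph V) (x y : V) (m : ℕ) : Finset V :=
  {w | G.Reachable w x ∧ G.dist w x < m ∧ G.dist w y = G.dist w x + 1}

open Classical in
/-- The vertices at distance at least `d` (possibly infinite) from both `x` and `y`. -/
noncomputable def farFrom (G : SimpleGraph V) (d : ℕ) (x y : V) : Finset V :=
  {w | G.Reachable w x → d ≤ G.dist w x ∧ d ≤ G.dist w y}

variable [DecidableRel G.Adj] {q d : ℕ} {x y : V}

/-- Double counting of edges between levels: only one neighbour leads back towards the edge, the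
other `q` go one level out, and no outer vertex is reached twice. -/
theorem card_edgeLevel_mul_le (hreg : G.IsRegularOfDegree (q + 1)) (hg : G.girth = 2 * d)
    (hxy : G.Adj x y) {i : ℕ} (hi : i + 2 ≤ d) :
    (G.edgeLevel x y i).card * q ≤ (G.edgeLevel x y (i + 1)).card := by
  classical
  have key := Finset.card_mul_le_card_mul (s := G.edgeLevel x y i) (t := G.edgeLevel x y (i + 1))
    (m := q) (n := 1) G.Adj ?_ ?_
  · simpa using key
  · intro a ha
    simp only [edgeLevel, Finset.mem_filter, Finset.mem_univ, true_and] at ha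
    obtain ⟨har, hax, hay⟩ := ha
    obtain ⟨p, hap, hpy⟩ := exists_adj_dist_eq hay
    have hsub : (G.neighborFinset a).erase p ⊆
        Finset.bipartiteAbove G.Adj (G.edgeLevel x y (i + 1)) a := by
      intro z hz
      simp only [Finset.mem_erase, mem_neighborFinset] at hz
      obtain ⟨hzp, haz⟩ := hz
      have h1 : G.dist z y ≠ i := fun h =>
        hzp (eq_of_adj_of_dist_lt_girth haz hap hay h hpy (by omega))
      have h2 := haz.dist_ne_dist_of_lt_girth (har.trans hxy.reachable) (by omega)
      have h3 := haz.dist_le_dist_add_one y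
      have h4 := haz.symm.dist_le_dist_add_one y
      have h5 := haz.symm.dist_le_dist_add_one x
      have h6 := hxy.symm.dist_le_dist_add_one z
      rw [G.dist_comm (u := y), G.dist_comm (u := x)] at h6
      simp only [Finset.mem_bipartiteAbove, edgeLevel, Finset.mem_filter, Finset.mem_univ, true_and]
      exact ⟨⟨haz.symm.reachable.trans har, by omega, by omega⟩, haz⟩
    refine le_trans ?_ (Finset.card_le_card hsub)
    rw [Finset.card_erase_of_mem (by simpa using hap), card_neighborFinset_eq_degree,
      hreg.degree_eq]
    omega
  · intro b hb
    simp only [edgeLevel, Finset.mem_filter, Finset.mem_univ, true_and] at hb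
    rw [Finset.card_le_one]
    intro w₁ h₁ w₂ h₂
    simp only [Finset.mem_bipartiteBelow, edgeLevel, Finset.mem_filter, Finset.mem_univ,
      true_and] at h₁ h₂
    exact eq_of_adj_of_dist_lt_girth h₁.2.symm h₂.2.symm hb.2.1 h₁.1.2.1 h₂.1.2.1 (by omega)

theorem pow_le_card_edgeLevel (hreg : G.IsRegularOfDegree (q + 1)) (hg : G.girth = 2 * d)
    (hxy : G.Adj x y) {i : ℕ} (hi : i + 1 ≤ d) : q ^ i ≤ (G.edgeLevel x y i).card := by
  induction i with
  | zero =>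
    rw [pow_zero, Finset.one_le_card]
    exact ⟨x, by simp [edgeLevel, dist_eq_one_iff_adj.2 hxy]⟩
  | succ i ih =>
    rw [pow_succ]
    exact (Nat.mul_le_mul_right q (ih (by omega))).trans (card_edgeLevel_mul_le hreg hg hxy hi)

theorem sum_pow_le_card_edgeBall (hreg : G.IsRegularOfDegree (q + 1)) (hg : G.girth = 2 * d)
    (hxy : G.Adj x y) {m : ℕ} (hm : m ≤ d) :
    ∑ i ∈ Finset.range m, q ^ i ≤ (G.edgeBall x y m).card := by
  classical
  induction m with
  | zero => simp
  | succ m ih =>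
    have hdisj : Disjoint (G.edgeBall x y m) (G.edgeLevel x y m) := by
      rw [Finset.disjoint_left]
      intro w hw hw'
      simp only [edgeBall, edgeLevel, Finset.mem_filter] at hw hw'
      omega
    rw [Finset.sum_range_succ]
    refine (Nat.add_le_add (ih (by omega)) (pow_le_card_edgeLevel hreg hg hxy hm)).trans ?_
    rw [← Finset.card_union_of_disjoint hdisj]
    apply Finset.card_le_card
    intro w hw
    simp only [Finset.mem_union, edgeBall, edgeLevel, Finset.mem_filter, Finset.mem_univ,
      true_and] at hw ⊢
    rcases hw with ⟨hr, h1, h2⟩ | ⟨hr, h1, h2⟩ <;> exact ⟨hr, by omega, by omega⟩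

theorem card_farFrom_add_le (hreg : G.IsRegularOfDegree (q + 1)) (hg : G.girth = 2 * d)
    (hxy : G.Adj x y) :
    (G.farFrom d x y).card + 2 * ∑ i ∈ Finset.range d, q ^ i ≤ Fintype.card V := by
  classical
  have hd1 : Disjoint (G.edgeBall x y d) (G.edgeBall y x d) := by
    rw [Finset.disjoint_left]
    intro w hw hw'
    simp only [edgeBall, Finset.mem_filter] at hw hw'
    omega
  have hd2 : Disjoint (G.farFrom d x y) (G.edgeBall x y d ∪ G.edgeBall y x d) := by
    rw [Finset.disjoint_left]
    intro w hw hw'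
    simp only [farFrom, edgeBall, Finset.mem_union, Finset.mem_filter, Finset.mem_univ,
      true_and] at hw hw'
    rcases hw' with ⟨hr, h⟩ | ⟨hr, h⟩
    · have := hw hr
      omega
    · have := hw (hr.trans hxy.symm.reachable)
      omega
  have h1 := sum_pow_le_card_edgeBall hreg hg hxy le_rfl
  have h2 := sum_pow_le_card_edgeBall hreg hg hxy.symm le_rfl
  have h3 := Finset.card_le_univ (G.farFrom d x y ∪ (G.edgeBall x y d ∪ G.edgeBall y x d))
  rw [Finset.card_union_of_disjoint hd2, Finset.card_union_of_disjoint hd1] at h3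
  omega

theorem card_farFrom_le_of_excess (hreg : G.IsRegularOfDegree (q + 1)) (hg : G.girth = 2 * d)
    {e : ℕ} (he : G.excess (q + 1) (2 * d) = e) (hxy : G.Adj x y) :
    (G.farFrom d x y).card ≤ e := by
  have h := card_farFrom_add_le hreg hg hxy
  have h2 : (Fintype.card V : ℤ) = e + 2 * ∑ i ∈ Finset.range d, (q : ℤ) ^ i := by
    simp only [excess, mooreBound, even_two_mul, if_true] at he
    simp at he
    linarith
  zify at h
  linarith

/-- A closed neighbourhood has `q + 2` vertices, too many for the far set. -/
theorem exists_adj_notMem_farFrom (hreg : G.IsRegularOfDegree (q + 1))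
    (hfar : (G.farFrom d x y).card ≤ q) {w : V} (hw : w ∈ G.farFrom d x y) :
    ∃ z, G.Adj w z ∧ z ∉ G.farFrom d x y := by
  classical
  by_contra! h
  have hsub : insert w (G.neighborFinset w) ⊆ G.farFrom d x y := by
    intro z hz
    rw [Finset.mem_insert, mem_neighborFinset] at hz
    rcases hz with rfl | hz
    · exact hw
    · exact h z hz
  have := Finset.card_le_card hsub
  rw [Finset.card_insert_of_notMem (by simp), card_neighborFinset_eq_degree, hreg.degree_eq] at this
  omega

theorem connected_of_card_farFrom_le (hreg : G.IsRegularOfDegree (q + 1))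
    (hfar : ∀ x y, G.Adj x y → (G.farFrom d x y).card ≤ q) [Nonempty V] : G.Connected := by
  classical
  obtain ⟨x⟩ := ‹Nonempty V›
  have hdeg : 0 < G.degree x := by rw [hreg.degree_eq]; omega
  obtain ⟨y, hxy⟩ := (G.degree_pos_iff_exists_adj x).1 hdeg
  have hnot : ∀ z, z ∉ G.farFrom d x y → G.Reachable z x := by
    intro z hz
    simp only [farFrom, Finset.mem_filter, Finset.mem_univ, true_and] at hz
    by_contra h
    exact hz fun h' => absurd h' h
  have hx : ∀ w, G.Reachable w x := by
    intro w
    by_cases hw : w ∈ G.farFrom d x y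
    · obtain ⟨z, hwz, hz⟩ := exists_adj_notMem_farFrom hreg (hfar x y hxy) hw
      exact hwz.reachable.trans (hnot z hz)
    · exact hnot w hw
  exact (connected_iff_exists_forall_reachable G).2 ⟨x, fun w => (hx w).symm⟩

end Counting

/-! ### Small excess forces bipartiteness -/

section Equidistant

variable {V : Type*} [Fintype V] {G : SimpleGraph V}

theorem Connected.mem_farFrom (hc : G.Connected) {d : ℕ} {x y w : V} :
    w ∈ G.farFrom d x y ↔ d ≤ G.dist w x ∧ d ≤ G.dist w y := by
  simp [farFrom, hc.preconnected w x]

open Classical in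
/-- The neighbours of `w` far from the edge `xy`. -/
noncomputable def farNbrs (G : SimpleGraph V) (d : ℕ) (x y w : V) : Finset V :=
  {z ∈ G.farFrom d x y | G.Adj w z}

theorem mem_farNbrs {d : ℕ} {x y w z : V} :
    z ∈ G.farNbrs d x y w ↔ z ∈ G.farFrom d x y ∧ G.Adj w z := by
  simp [farNbrs]

theorem farNbrs_subset {d : ℕ} {x y w : V} : G.farNbrs d x y w ⊆ G.farFrom d x y :=
  fun _ hz => (mem_farNbrs.1 hz).1

variable [DecidableRel G.Adj] {q d : ℕ} {x y u v : V}

/-- The neighbours of `w` at distance `d` from `x`. -/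
noncomputable def nbrsAtDist (G : SimpleGraph V) [DecidableRel G.Adj] (w x : V) (d : ℕ) :
    Finset V :=
  {z | G.Adj w z ∧ G.dist z x = d}

theorem mem_nbrsAtDist {w z : V} :
    z ∈ G.nbrsAtDist w x d ↔ G.Adj w z ∧ G.dist z x = d := by
  simp [nbrsAtDist]

/-- Send `z` to the neighbour `c` of `x` on a geodesic from `z` to `x`. Then `c` is at distance `d +
1` from `v`, so the geodesic is unique and `c` determines `z`. -/
theorem card_nbrsAtDist_le_card_nbrsAtDist_swap (hg : G.girth = 2 * (d + 2))
    (hv : G.dist v x = d + 2) :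
    (G.nbrsAtDist v x (d + 1)).card ≤ (G.nbrsAtDist x v (d + 1)).card := by
  classical
  apply Finset.card_le_card_of_forall_subsingleton (fun z c => G.dist z c = d)
  · intro z hz
    rw [mem_nbrsAtDist] at hz
    obtain ⟨c, hxc, hcz⟩ := exists_adj_dist_eq ((G.dist_comm).trans hz.2)
    have h1 := hxc.dist_le_dist_add_one v
    have h2 := hz.1.dist_le_dist_add_one c
    rw [G.dist_comm] at hcz
    rw [G.dist_comm] at hv
    rw [G.dist_comm (u := v)] at h2
    exact ⟨c, mem_nbrsAtDist.2 ⟨hxc, by omega⟩, hcz⟩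
  · intro c hc z₁ h₁ z₂ h₂
    simp only [Set.mem_ofPred_eq, mem_nbrsAtDist] at hc h₁ h₂
    exact eq_of_adj_of_dist_lt_girth h₁.1.1 h₂.1.1 (G.dist_comm.trans hc.2) h₁.2 h₂.2 (by omega)

theorem Connected.card_nbrsAtDist_add_card_nbrsAtDist_le (hc : G.Connected)
    (hreg : G.IsRegularOfDegree (q + 1)) (hg : G.girth = 2 * (d + 2)) (huv : G.Adj u v)
    (hu : G.dist u x = d + 2) (hv : G.dist v x = d + 2) :
    (G.nbrsAtDist u x (d + 1)).card + (G.nbrsAtDist v x (d + 1)).card ≤ q + 1 := by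
  classical
  have hdisj : Disjoint (G.nbrsAtDist x u (d + 1)) (G.nbrsAtDist x v (d + 1)) := by
    rw [Finset.disjoint_left]
    intro c h₁ h₂
    rw [mem_nbrsAtDist, G.dist_comm] at h₁ h₂
    exact huv.dist_ne_dist_of_lt_girth (hc.preconnected u c) (by omega) (h₁.2.trans h₂.2.symm)
  refine (Nat.add_le_add (card_nbrsAtDist_le_card_nbrsAtDist_swap hg hu)
    (card_nbrsAtDist_le_card_nbrsAtDist_swap hg hv)).trans ?_
  rw [← Finset.card_union_of_disjoint hdisj, ← hreg.degree_eq x, ← card_neighborFinset_eq_degree]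
  apply Finset.card_le_card
  intro c h
  rw [Finset.mem_union, mem_nbrsAtDist, mem_nbrsAtDist] at h
  rw [mem_neighborFinset]
  tauto

/-- Each of the `q + 1` neighbours of `u` is far from `xy` or at distance `d + 1` from `x`; the
previous bound on the latter leaves enough far ones. -/
theorem Connected.card_nbrsAtDist_le_card_farNbrs (hc : G.Connected)
    (hreg : G.IsRegularOfDegree (q + 1)) (hg : G.girth = 2 * (d + 2)) (hxy : G.Adj x y)
    (huv : G.Adj u v) (hvx : G.dist v x = d + 2) (hvy : G.dist v y = d + 2)
    (huy : G.dist u y = d + 1) :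
    (G.nbrsAtDist v x (d + 1)).card ≤ (G.farNbrs (d + 2) x y u).card := by
  classical
  have hux : G.dist u x = d + 2 := by
    have h1 := hxy.dist_le_dist_add_one u
    rw [G.dist_comm, G.dist_comm (u := y)] at h1
    have h2 := huv.symm.dist_le_dist_add_one x
    have h3 : G.dist x u ≠ G.dist y u := by
      intro h
      refine hxy.dist_ne_dist_of_lt_girth (hc.preconnected x u) ?_ h
      rw [h, G.dist_comm]
      omega
    rw [G.dist_comm, G.dist_comm (u := y)] at h3
    omega
  have hsub : G.neighborFinset u ⊆
      G.farNbrs (d + 2) x y u ∪ G.nbrsAtDist u x (d + 1) := by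
    intro z hz
    rw [mem_neighborFinset] at hz
    rw [Finset.mem_union, mem_nbrsAtDist]
    by_cases hzX : z ∈ G.farFrom (d + 2) x y
    · exact Or.inl (mem_farNbrs.2 ⟨hzX, hz⟩)
    · right
      rw [hc.mem_farFrom] at hzX
      have h1 := hz.dist_le_dist_add_one x
      have h2 := hxy.dist_le_dist_add_one z
      rw [G.dist_comm, G.dist_comm (u := y)] at h2
      have h3 := hz.dist_ne_dist_of_lt_girth (hc.preconnected u y) (by omega)
      exact ⟨hz, by omega⟩
  have h1 := (Finset.card_le_card hsub).trans (Finset.card_union_le _ _)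
  rw [card_neighborFinset_eq_degree, hreg.degree_eq] at h1
  have h2 := hc.card_nbrsAtDist_add_card_nbrsAtDist_le hreg hg huv hux hvx
  omega

/-- The far neighbours of `v`, `u` and `t` number at least `q + 1` with multiplicity. Without
triangles and 4-cycles only `v` can be counted twice, so at least `q` vertices are far. -/
theorem Connected.not_dist_eq_dist_of_card_farFrom_lt (hc : G.Connected)
    (hreg : G.IsRegularOfDegree (q + 1)) (hg : G.girth = 2 * (d + 2)) (hd : 1 ≤ d)
    (hxy : G.Adj x y) (hfar : (G.farFrom (d + 2) x y).card < q) (hvx : G.dist v x = d + 2)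
    (hvy : G.dist v y = d + 2) : False := by
  classical
  obtain ⟨u, hvu, huy⟩ := exists_adj_dist_eq hvy
  obtain ⟨t, hvt, htx⟩ := exists_adj_dist_eq hvx
  have hu := hc.card_nbrsAtDist_le_card_farNbrs hreg hg hxy hvu.symm hvx hvy huy
  have ht := hc.card_nbrsAtDist_le_card_farNbrs hreg hg hxy.symm hvt.symm hvy hvx htx
  have hcomm : G.farNbrs (d + 2) y x t = G.farNbrs (d + 2) x y t := by
    ext z
    simp only [mem_farNbrs, hc.mem_farFrom]
    tauto
  rw [hcomm] at ht
  have hsub : G.neighborFinset v ⊆ G.farNbrs (d + 2) x y v ∪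
      (G.nbrsAtDist v x (d + 1) ∪ G.nbrsAtDist v y (d + 1)) := by
    intro z hz
    rw [mem_neighborFinset] at hz
    rw [Finset.mem_union, Finset.mem_union, mem_nbrsAtDist, mem_nbrsAtDist]
    by_cases hzX : z ∈ G.farFrom (d + 2) x y
    · exact Or.inl (mem_farNbrs.2 ⟨hzX, hz⟩)
    · right
      rw [hc.mem_farFrom] at hzX
      have h1 := hz.dist_le_dist_add_one x
      have h2 := hz.dist_le_dist_add_one y
      rcases lt_or_ge (G.dist z x) (d + 2) with h | h
      · exact Or.inl ⟨hz, by omega⟩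
      · exact Or.inr ⟨hz, by omega⟩
  have hdeg := (Finset.card_le_card hsub).trans ((Finset.card_union_le _ _).trans
    (Nat.add_le_add_left (Finset.card_union_le _ _) _))
  rw [card_neighborFinset_eq_degree, hreg.degree_eq] at hdeg
  have htri : ∀ {a b c : V}, G.Adj a b → G.Adj b c → ¬ G.Adj a c := by
    intro a b c hab hbc hac
    have h := dist_eq_one_iff_adj.2 hac
    exact hab.dist_ne_dist_of_lt_girth hac.reachable (by omega)
      (h.trans (dist_eq_one_iff_adj.2 hbc).symm)
  have hut : u ≠ t := by
    rintro rfl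
    have h1 := hxy.dist_ne_dist_of_lt_girth (hc.preconnected x u)
      (by rw [G.dist_comm]; omega)
    rw [G.dist_comm, G.dist_comm (u := y)] at h1
    omega
  have hdut : G.dist u t = 2 := by
    have h1 := hvu.symm.dist_le_dist_add_one t
    rw [dist_eq_one_iff_adj.2 hvt] at h1
    have h2 := hc.one_lt_dist_of_ne_of_not_adj hut (htri hvu.symm hvt)
    omega
  have hinter : G.farNbrs (d + 2) x y u ∩ G.farNbrs (d + 2) x y t ⊆ {v} := by
    intro z hz
    simp only [Finset.mem_inter, mem_farNbrs] at hz
    rw [Finset.mem_singleton]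
    exact eq_of_adj_of_dist_lt_girth hz.1.2 hvu.symm hdut
      (dist_eq_one_iff_adj.2 hz.2.2.symm) (dist_eq_one_iff_adj.2 hvt) (by omega)
  have hcard := Finset.card_union_add_card_inter (G.farNbrs (d + 2) x y u)
    (G.farNbrs (d + 2) x y t)
  have hone := Finset.card_le_card hinter
  rw [Finset.card_singleton] at hone
  have hdisj : Disjoint (G.farNbrs (d + 2) x y v)
      (G.farNbrs (d + 2) x y u ∪ G.farNbrs (d + 2) x y t) := by
    rw [Finset.disjoint_left]
    intro z hz hz'
    simp only [Finset.mem_union, mem_farNbrs] at hz hz'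
    rcases hz' with hz' | hz'
    · exact htri hvu hz'.2 hz.2
    · exact htri hvt hz'.2 hz.2
  have hall : G.farNbrs (d + 2) x y v ∪ (G.farNbrs (d + 2) x y u ∪ G.farNbrs (d + 2) x y t) ⊆
      G.farFrom (d + 2) x y :=
    Finset.union_subset farNbrs_subset (Finset.union_subset farNbrs_subset farNbrs_subset)
  have h := Finset.card_le_card hall
  rw [Finset.card_union_of_disjoint hdisj] at h
  omega

theorem Connected.min_dist_le_of_card_farFrom_le (hc : G.Connected)
    (hreg : G.IsRegularOfDegree (q + 1)) (hfar : (G.farFrom d x y).card ≤ q) (v : V) :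
    G.dist v x ≤ d ∨ G.dist v y ≤ d := by
  by_cases hv : v ∈ G.farFrom d x y
  · obtain ⟨z, hvz, hz⟩ := exists_adj_notMem_farFrom hreg hfar hv
    rw [hc.mem_farFrom] at hz
    have h1 := hvz.dist_le_dist_add_one x
    have h2 := hvz.dist_le_dist_add_one y
    omega
  · rw [hc.mem_farFrom] at hv
    omega

/-- A regular graph of even girth and small excess has no edge whose ends are equidistant from some
vertex; equivalently, it is bipartite. -/
theorem Connected.dist_ne_dist_of_card_farFrom_lt (hc : G.Connected)
    (hreg : G.IsRegularOfDegree (q + 1)) (hg : G.girth = 2 * d) (hd : 3 ≤ d)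
    (hfar : ∀ x y, G.Adj x y → (G.farFrom d x y).card < q) (hxy : G.Adj x y) (v : V) :
    G.dist v x ≠ G.dist v y := by
  intro h
  obtain ⟨d, rfl⟩ : ∃ c, d = c + 2 := ⟨d - 2, by omega⟩
  have h1 := hc.min_dist_le_of_card_farFrom_le hreg (hfar x y hxy).le v
  by_cases h2 : G.dist v x = d + 2
  · exact hc.not_dist_eq_dist_of_card_farFrom_lt hreg hg (by omega) hxy (hfar x y hxy) h2
      (h.symm.trans h2)
  · refine hxy.dist_ne_dist_of_lt_girth (hc.preconnected x v) ?_
      ((G.dist_comm).trans (h.trans G.dist_comm))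
    rw [G.dist_comm]
    omega

theorem Connected.dist_le_of_card_farFrom_le (hc : G.Connected)
    (hreg : G.IsRegularOfDegree (q + 1))
    (hfar : ∀ x y, G.Adj x y → (G.farFrom d x y).card ≤ q) (v x : V) :
    G.dist v x ≤ d + 1 := by
  have hdeg : 0 < G.degree x := by rw [hreg.degree_eq]; omega
  obtain ⟨y, hxy⟩ := (G.degree_pos_iff_exists_adj x).1 hdeg
  have h1 := hc.min_dist_le_of_card_farFrom_le hreg (hfar x y hxy) v
  have h2 := hxy.dist_le_dist_add_one v
  rw [G.dist_comm, G.dist_comm (u := y)] at h2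
  omega

end Equidistant

/-! ### Arithmetic of the non-backtracking polynomials -/

/-- The polynomials counting non-backtracking walks in a `(q + 1)`-regular graph by parity, evaluated
at `x`. -/
def nonbacktrackingPoly (q x : ℤ) : ℕ → ℤ
  | 0 => 1
  | 1 => x
  | j + 2 => x * nonbacktrackingPoly q x (j + 1) - q * nonbacktrackingPoly q x j

theorem odd_nonbacktrackingPoly {q x : ℤ} (hq : Even q) (hx : Odd x) (j : ℕ) :
    Odd (nonbacktrackingPoly q x j) := by
  induction j using Nat.twoStepInduction with
  | zero => exact odd_one
  | one => exact hx
  | more j _ ih => exact (hx.mul ih).sub_even (hq.mul_right _)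

theorem even_nonbacktrackingPoly {q x : ℤ} (hq : Even q) (hx : Even x) (j : ℕ) :
    Even (nonbacktrackingPoly q x (j + 1)) := by
  cases j with
  | zero => exact hx
  | succ j => exact (hx.mul_right _).sub (hq.mul_right _)

theorem four_dvd_nonbacktrackingPoly {q x : ℤ} (hq : Even q) (hx : Even x) (j : ℕ) :
    4 ∣ nonbacktrackingPoly q x (j + 3) := by
  have h1 := even_nonbacktrackingPoly hq hx (j + 1)
  have h2 := even_nonbacktrackingPoly hq hx j
  have h4 : (4 : ℤ) = 2 * 2 := by norm_num
  rw [nonbacktrackingPoly, h4]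
  exact dvd_sub (mul_dvd_mul hx.two_dvd h1.two_dvd) (mul_dvd_mul hq.two_dvd h2.two_dvd)

theorem nonbacktrackingPoly_ne_neg_two {q : ℤ} (hq : Even q) (x : ℤ) {j : ℕ} (hj : 3 ≤ j) :
    nonbacktrackingPoly q x j ≠ -2 := by
  intro h
  rcases Int.even_or_odd x with hx | hx
  · obtain ⟨i, rfl⟩ : ∃ i, j = i + 3 := ⟨j - 3, by omega⟩
    have := four_dvd_nonbacktrackingPoly hq hx i
    omega
  · have := odd_nonbacktrackingPoly hq hx j
    rw [h] at this
    exact absurd this (by decide)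

/-! ### Components of the excess graph -/

section TwoCycles

variable {V : Type*} {H : SimpleGraph V}

theorem card_neighborSet_cycleGraph {n : ℕ} (hn : 3 ≤ n) (v : Fin n) :
    Nat.card ((cycleGraph n).neighborSet v) = 2 := by
  obtain ⟨m, rfl⟩ : ∃ m, n = m + 3 := ⟨n - 3, by omega⟩
  rw [Nat.card_eq_fintype_card, card_neighborSet_eq_degree, cycleGraph_degree_three_le]

/-- A disjoint union of two cycles is 2-regular with exactly two connected components. -/
theorem IsDisjointUnionOfTwoCycles.exists_set (h : H.IsDisjointUnionOfTwoCycles) :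
    ∃ C : Set V, C.Nonempty ∧ Cᶜ.Nonempty ∧ (∀ u v, H.Adj u v → (u ∈ C ↔ v ∈ C)) ∧
      (∀ u v, (u ∈ C ↔ v ∈ C) → H.Reachable u v) ∧ ∀ v, Nat.card (H.neighborSet v) = 2 := by
  obtain ⟨a, b, ha, hb, ⟨φ⟩⟩ := h
  refine ⟨{v | (φ v).isLeft}, ⟨φ.symm (.inl ⟨0, by omega⟩), by simp⟩,
    ⟨φ.symm (.inr ⟨0, by omega⟩), by simp⟩, ?_, ?_, ?_⟩
  · intro u v huv
    have h := φ.map_adj_iff.2 huv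
    rw [Set.mem_ofPred_eq, Set.mem_ofPred_eq]
    generalize φ u = x at h ⊢
    generalize φ v = y at h ⊢
    rcases x with x | x <;> rcases y with y | y <;> simp_all [SimpleGraph.sum]
  · intro u v huv
    rw [Set.mem_ofPred_eq, Set.mem_ofPred_eq] at huv
    rw [← φ.reachable_iff]
    generalize φ u = x at huv ⊢
    generalize φ v = y at huv ⊢
    rcases x with x | x <;> rcases y with y | y <;> simp at huv
    · exact (cycleGraph_preconnected x y).map Embedding.sumInl.toHom
    · exact (cycleGraph_preconnected x y).map Embedding.sumInr.toHom
  · intro v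
    rw [Nat.card_congr (φ.mapNeighborSet v)]
    rcases φ v with x | x
    · rw [neighborSet_sum_inl, Nat.card_image_of_injective Sum.inl_injective,
        card_neighborSet_cycleGraph ha]
    · rw [neighborSet_sum_inr, Nat.card_image_of_injective Sum.inr_injective,
        card_neighborSet_cycleGraph hb]

end TwoCycles

/-! ### Distance matrices of a bipartite regular graph -/

section Spectral

open Matrix

variable {V : Type*} {G : SimpleGraph V}

/-- The matrix of pairs of vertices at distance at most `j` and of the same parity as `j`. -/
noncomputable def parityBallMatrix (G : SimpleGraph V) (j : ℕ) : Matrix V V ℝ :=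
  of fun u v => if G.dist u v ≤ j ∧ Even (G.dist u v + j) then 1 else 0

/-- The matrix of pairs of vertices at odd distance. -/
noncomputable def oddDistMatrix (G : SimpleGraph V) : Matrix V V ℝ :=
  of fun u v => if Odd (G.dist u v) then 1 else 0

theorem Walk.even_dist_add_length_add_dist
    (hne : ∀ u v w, G.Adj u v → G.dist w u ≠ G.dist w v) (x : V) {u v : V} (p : G.Walk u v) :
    Even (G.dist x u + p.length + G.dist x v) := by
  induction p with
  | nil => simp
  | cons h p ih =>
    have h1 := hne _ _ x h
    have h2 := h.dist_le_dist_add_one x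
    have h3 := h.symm.dist_le_dist_add_one x
    simp only [G.dist_comm (v := x)] at h2 h3
    rw [Walk.length_cons]
    grind

theorem excessGraph_adj {d : ℕ} {u v : V} : (G.excessGraph d).Adj u v ↔ G.dist u v = d + 1 :=
  Iff.rfl

theorem oddDistMatrix_transpose : G.oddDistMatrixᵀ = G.oddDistMatrix := by
  ext u v
  simp [oddDistMatrix, G.dist_comm]

theorem parityBallMatrix_zero [DecidableEq V] (hc : G.Connected) : G.parityBallMatrix 0 = 1 := by
  ext u v
  simp only [parityBallMatrix, of_apply, Matrix.one_apply]
  congr 1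
  rw [← hc.dist_eq_zero_iff]
  grind

theorem parityBallMatrix_one [DecidableRel G.Adj] : G.parityBallMatrix 1 = G.adjMatrix ℝ := by
  ext u v
  simp only [parityBallMatrix, of_apply, adjMatrix_apply]
  congr 1
  rw [← dist_eq_one_iff_adj]
  grind

open Classical in
theorem oddDistMatrix_eq_parityBallMatrix_add_adjMatrix_excessGraph {d : ℕ} (hd : Even d)
    (hd1 : 1 ≤ d)
    (hdist : ∀ u v, G.dist u v ≤ d + 1) :
    G.oddDistMatrix = G.parityBallMatrix (d - 1) + (G.excessGraph d).adjMatrix ℝ := by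
  ext u v
  simp only [oddDistMatrix, parityBallMatrix, of_apply, Matrix.add_apply,
    adjMatrix_apply, excessGraph_adj]
  have := hdist u v
  by_cases h : Odd (G.dist u v)
  · by_cases h' : G.dist u v = d + 1
    · rw [if_pos h, if_neg (by omega), if_pos h', zero_add]
    · rw [if_pos h, if_pos ⟨by grind, by grind⟩, if_neg h', add_zero]
  · rw [if_neg h, if_neg (by grind), if_neg (by grind), add_zero]

open Classical in
/-- A function that is invariant under the adjacency of a 2-regular excess graph has constant sums
over the vertices at odd distance. -/
theorem oddDistMatrix_mulVec_of_excessGraph [Fintype V] {d : ℕ} (hd : Even d)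
    (hne : ∀ u v w, G.Adj u v → G.dist w u ≠ G.dist w v)
    (hE : (G.excessGraph d).IsRegularOfDegree 2) {f : V → ℝ}
    (hf : (G.excessGraph d).adjMatrix ℝ *ᵥ f = (2 : ℝ) • f) (u : V) :
    (G.oddDistMatrix *ᵥ f) u = (∑ v, f v) / 2 := by
  -- Excess edges join vertices at odd distance `d + 1`, so they switch sides of the bipartition.
  have hKE : G.oddDistMatrix * (G.excessGraph d).adjMatrix ℝ =
      (2 : ℝ) • (of (fun _ _ => 1) - G.oddDistMatrix) := by
    ext v w
    rw [mul_adjMatrix_apply]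
    have hstep : ∀ z ∈ (G.excessGraph d).neighborFinset w,
        G.oddDistMatrix v z = 1 - G.oddDistMatrix v w := by
      intro z hz
      rw [mem_neighborFinset] at hz
      have hz' : G.dist w z = d + 1 := hz
      obtain ⟨p, hp⟩ := exists_walk_of_dist_ne_zero (G := G) (u := w) (v := z) (by omega)
      have h1 := Walk.even_dist_add_length_add_dist hne v p
      rw [hp, hz'] at h1
      simp only [oddDistMatrix, of_apply]
      by_cases h : Odd (G.dist v w)
      · rw [if_neg (by grind), if_pos h, sub_self]
      · rw [if_pos (by grind), if_neg h, sub_zero]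
    rw [Finset.sum_congr rfl hstep]
    simp [hE.degree_eq]
    ring
  have h := congrFun (congrArg (fun M => M *ᵥ f) hKE) u
  simp only [← mulVec_mulVec, hf, mulVec_smul, smul_mulVec, sub_mulVec, Pi.smul_apply,
    Pi.sub_apply, smul_eq_mul] at h
  have h1 : ((of fun _ _ => (1 : ℝ)) *ᵥ f) u = ∑ v, f v := by
    simp [mulVec, dotProduct]
  rw [h1] at h
  linarith

variable [Fintype V] [DecidableRel G.Adj] {q : ℕ}

/-- In matching parity, all `q + 1` neighbours of `v` count when `w` is within `j`, and exactly one
when `w` is at distance `j + 2`, by uniqueness of geodesics. -/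
theorem adjMatrix_mul_parityBallMatrix (hreg : G.IsRegularOfDegree (q + 1))
    (hne : ∀ u v w, G.Adj u v → G.dist w u ≠ G.dist w v) {j : ℕ} (hj : 2 * (j + 2) < G.girth) :
    G.adjMatrix ℝ * G.parityBallMatrix (j + 1) =
      G.parityBallMatrix (j + 2) + (q : ℝ) • G.parityBallMatrix j := by
  classical
  ext v w
  rw [adjMatrix_mul_apply]
  simp only [parityBallMatrix, of_apply, Matrix.add_apply, Matrix.smul_apply, smul_eq_mul]
  have hstep : ∀ z ∈ G.neighborFinset v,
      G.dist z w = G.dist v w + 1 ∨ G.dist z w + 1 = G.dist v w := by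
    intro z hz
    rw [mem_neighborFinset] at hz
    have h1 := hne _ _ w hz
    have h2 := hz.dist_le_dist_add_one w
    have h3 := hz.symm.dist_le_dist_add_one w
    rw [G.dist_comm (u := w), G.dist_comm (u := w)] at h1
    omega
  by_cases hpar : Even (G.dist v w + j)
  · rcases lt_trichotomy (G.dist v w) (j + 2) with hlt | heq | hgt
    · have hle : G.dist v w ≤ j := by grind
      rw [Finset.sum_congr rfl (g := fun _ => (1 : ℝ)), if_pos, if_pos ⟨hle, hpar⟩]
      · simp [hreg.degree_eq]
        ring
      · exact ⟨by omega, by grind⟩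
      · intro z hz
        have := hstep z hz
        rw [if_pos]
        exact ⟨by omega, by grind⟩
    · obtain ⟨z, hvz, hz⟩ := exists_adj_dist_eq (j := j + 1) heq
      rw [Finset.sum_eq_single z, if_pos, if_pos, if_neg]
      · simp
      · omega
      · exact ⟨by omega, by grind⟩
      · exact ⟨by omega, by grind⟩
      · intro z' hz' hzz
        have := hstep z' hz'
        rw [if_neg]
        rintro ⟨h1, -⟩
        rw [mem_neighborFinset] at hz'
        exact hzz (eq_of_adj_of_dist_lt_girth hz' hvz heq (by omega) hz hj)
      · simp [hvz]
    · rw [Finset.sum_eq_zero, if_neg, if_neg]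
      · simp
      · omega
      · omega
      · intro z hz
        have := hstep z hz
        rw [if_neg]
        omega
  · rw [Finset.sum_eq_zero, if_neg, if_neg]
    · simp
    · tauto
    · grind
    · intro z hz
      have := hstep z hz
      rw [if_neg]
      grind

theorem adjMatrix_mul_oddDistMatrix_apply (hreg : G.IsRegularOfDegree (q + 1))
    (hne : ∀ u v w, G.Adj u v → G.dist w u ≠ G.dist w v) (v w : V) :
    (G.adjMatrix ℝ * G.oddDistMatrix) v w = if Even (G.dist v w) then (q + 1 : ℝ) else 0 := by
  rw [adjMatrix_mul_apply]
  have hstep : ∀ z ∈ G.neighborFinset v,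
      G.oddDistMatrix z w = if Even (G.dist v w) then (1 : ℝ) else 0 := by
    intro z hz
    rw [mem_neighborFinset] at hz
    have h1 := Walk.even_dist_add_length_add_dist hne w (Walk.cons hz Walk.nil)
    rw [G.dist_comm, G.dist_comm (u := w)] at h1
    simp only [oddDistMatrix, of_apply]
    simp only [Walk.length_cons, Walk.length_nil] at h1
    congr 1
    grind
  rw [Finset.sum_congr rfl hstep]
  simp [hreg.degree_eq]

/-- The product of these symmetric matrices depends only on distance, so it is symmetric. -/
theorem commute_adjMatrix_oddDistMatrix [DecidableEq V] (hreg : G.IsRegularOfDegree (q + 1))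
    (hne : ∀ u v w, G.Adj u v → G.dist w u ≠ G.dist w v) :
    Commute (G.adjMatrix ℝ) G.oddDistMatrix := by
  have h : (G.adjMatrix ℝ * G.oddDistMatrix)ᵀ = G.adjMatrix ℝ * G.oddDistMatrix := by
    ext u v
    rw [transpose_apply, adjMatrix_mul_oddDistMatrix_apply hreg hne,
      adjMatrix_mul_oddDistMatrix_apply hreg hne, G.dist_comm]
  rw [Commute, SemiconjBy, ← h, transpose_mul, transpose_adjMatrix, oddDistMatrix_transpose]

theorem commute_adjMatrix_parityBallMatrix [DecidableEq V] (hc : G.Connected)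
    (hreg : G.IsRegularOfDegree (q + 1)) (hne : ∀ u v w, G.Adj u v → G.dist w u ≠ G.dist w v)
    {j : ℕ} (hj : 2 * j < G.girth) : Commute (G.adjMatrix ℝ) (G.parityBallMatrix j) := by
  induction j using Nat.twoStepInduction with
  | zero => rw [parityBallMatrix_zero hc]; exact Commute.one_right _
  | one => rw [parityBallMatrix_one]
  | more j ih₁ ih₂ =>
    rw [← sub_eq_of_eq_add (adjMatrix_mul_parityBallMatrix hreg hne hj)]
    exact ((Commute.refl _).mul_right (ih₂ (by omega))).sub_right
      ((ih₁ (by omega)).smul_right _)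

theorem parityBallMatrix_mulVec [DecidableEq V] (hc : G.Connected)
    (hreg : G.IsRegularOfDegree (q + 1)) (hne : ∀ u v w, G.Adj u v → G.dist w u ≠ G.dist w v)
    {f : V → ℝ} {a : ℤ} {b : ℝ} (hf : G.adjMatrix ℝ *ᵥ f = (a : ℝ) • f + b • 1)
    {j : ℕ} (hj : 2 * j < G.girth) :
    ∃ c : ℝ, G.parityBallMatrix j *ᵥ f = (nonbacktrackingPoly q a j : ℝ) • f + c • 1 := by
  have hone : G.adjMatrix ℝ *ᵥ 1 = (q + 1 : ℝ) • (1 : V → ℝ) := by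
    ext v
    simp [adjMatrix_mulVec_apply, hreg.degree_eq]
  induction j using Nat.twoStepInduction with
  | zero => exact ⟨0, by simp [parityBallMatrix_zero hc, nonbacktrackingPoly]⟩
  | one => exact ⟨b, by simp [parityBallMatrix_one, nonbacktrackingPoly, hf]⟩
  | more j ih₁ ih₂ =>
    obtain ⟨c₁, h₁⟩ := ih₁ (by omega)
    obtain ⟨c₂, h₂⟩ := ih₂ (by omega)
    refine ⟨nonbacktrackingPoly q a (j + 1) * b + c₂ * (q + 1) - q * c₁, ?_⟩
    rw [← sub_eq_of_eq_add (adjMatrix_mul_parityBallMatrix hreg hne hj), sub_mulVec,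
      smul_mulVec, ← mulVec_mulVec, h₁, h₂, mulVec_add, mulVec_smul, mulVec_smul, hone, hf]
    ext v
    simp only [nonbacktrackingPoly, Pi.add_apply, Pi.sub_apply, Pi.smul_apply, Pi.one_apply,
      smul_eq_mul, mul_one]
    push_cast
    ring

end Spectral

/-! ### The eigenvalue equation and the contradiction -/

open Matrix

variable {V : Type*} [Fintype V] {G : SimpleGraph V} [DecidableRel G.Adj] {q d : ℕ}

open Classical in
theorem commute_adjMatrix_adjMatrix_excessGraph (hc : G.Connected)
    (hreg : G.IsRegularOfDegree (q + 1)) (hg : G.girth = 2 * d) (hd : Even d) (hd1 : 1 ≤ d)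
    (hne : ∀ u v w, G.Adj u v → G.dist w u ≠ G.dist w v)
    (hdist : ∀ u v, G.dist u v ≤ d + 1) :
    Commute (G.adjMatrix ℝ) ((G.excessGraph d).adjMatrix ℝ) := by
  rw [← sub_eq_of_eq_add'
    (oddDistMatrix_eq_parityBallMatrix_add_adjMatrix_excessGraph hd hd1 hdist)]
  exact (commute_adjMatrix_oddDistMatrix hreg hne).sub_right
    (commute_adjMatrix_parityBallMatrix hc hreg hne (by omega))

open Classical in
/-- If the excess graph of a bipartite graph `G` of diameter at most `d + 1` is 2-regular and has two
components, then some integer `a` is an eigenvalue of `G` at which the polynomial counting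
non-backtracking walks takes the value `-2`. -/
theorem exists_nonbacktrackingPoly_eq_neg_two (hc : G.Connected)
    (hreg : G.IsRegularOfDegree (q + 1)) (hg : G.girth = 2 * d) (hd : Even d) (hd1 : 1 ≤ d)
    (hne : ∀ u v w, G.Adj u v → G.dist w u ≠ G.dist w v)
    (hdist : ∀ u v, G.dist u v ≤ d + 1) (hE : (G.excessGraph d).IsRegularOfDegree 2)
    {C : Set V} (hC : C.Nonempty) (hC' : Cᶜ.Nonempty)
    (hadj : ∀ u v, (G.excessGraph d).Adj u v → (u ∈ C ↔ v ∈ C))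
    (hreach : ∀ u v, (u ∈ C ↔ v ∈ C) → (G.excessGraph d).Reachable u v) :
    ∃ a : ℤ, nonbacktrackingPoly q a (d - 1) = -2 := by
  obtain ⟨x, hx⟩ := hC
  obtain ⟨y, hy⟩ := hC'
  rw [Set.mem_compl_iff] at hy
  set f : V → ℝ := fun v => if v ∈ C then 1 else 0 with hfdef
  have hfx : f x = 1 := if_pos hx
  have hfy : f y = 0 := if_neg hy
  have hEf : (G.excessGraph d).adjMatrix ℝ *ᵥ f = (2 : ℝ) • f := by
    ext v
    rw [adjMatrix_mulVec_apply, Finset.sum_congr rfl (g := fun _ => f v)]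
    · simp [hE.degree_eq]
    · intro z hz
      rw [mem_neighborFinset] at hz
      simp only [hfdef, hadj v z hz]
  have hEA : (G.excessGraph d).adjMatrix ℝ *ᵥ (G.adjMatrix ℝ *ᵥ f) =
      (2 : ℝ) • (G.adjMatrix ℝ *ᵥ f) := by
    rw [mulVec_mulVec, ← (commute_adjMatrix_adjMatrix_excessGraph hc hreg hg hd hd1 hne hdist).eq,
      ← mulVec_mulVec, hEf, mulVec_smul]
  -- The kernel of the Laplacian consists of the functions constant on components.
  have hlap : (G.excessGraph d).lapMatrix ℝ *ᵥ (G.adjMatrix ℝ *ᵥ f) = 0 := by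
    ext v
    rw [lapMatrix_mulVec_apply, ← adjMatrix_mulVec_apply, hEA, hE.degree_eq]
    simp
  rw [lapMatrix_mulVec_eq_zero_iff_forall_reachable] at hlap
  have hint : ∀ v, ∃ n : ℤ, (G.adjMatrix ℝ *ᵥ f) v = n := by
    intro v
    refine ⟨∑ u ∈ G.neighborFinset v, if u ∈ C then 1 else 0, ?_⟩
    rw [adjMatrix_mulVec_apply]
    push_cast
    rfl
  obtain ⟨p, hp⟩ := hint x
  obtain ⟨r, hr⟩ := hint y
  have hA : G.adjMatrix ℝ *ᵥ f = ((p - r : ℤ) : ℝ) • f + (r : ℝ) • 1 := by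
    ext v
    by_cases hv : v ∈ C
    · rw [hlap v x (hreach v x (by tauto)), hp]
      simp [hfdef, hv]
    · rw [hlap v y (hreach v y (by tauto)), hr]
      simp [hfdef, hv]
  refine ⟨p - r, ?_⟩
  obtain ⟨c, hS⟩ := parityBallMatrix_mulVec hc hreg hne hA (j := d - 1) (by omega)
  have hK := oddDistMatrix_mulVec_of_excessGraph hd hne hE hEf
  rw [oddDistMatrix_eq_parityBallMatrix_add_adjMatrix_excessGraph hd hd1 hdist, add_mulVec, hS,
    hEf] at hK
  have h1 := hK x
  have h2 := hK y
  simp only [Pi.add_apply, Pi.smul_apply, Pi.one_apply, smul_eq_mul, hfx, hfy] at h1 h2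
  -- Subtracting the values at `x` and `y` cancels the constant vectors.
  have h3 : (nonbacktrackingPoly q (p - r) (d - 1) : ℝ) = -2 := by linarith
  exact_mod_cast h3

end SimpleGraph

theorem mainTheorem6 (k g d : ℕ) (hk : 7 ≤ k) (hk_odd : Odd k) (hg : g = 2 * d) (hg8 : 8 ≤ g)
    (hd : Even d) {V : Type*} [Fintype V] (G : SimpleGraph V) [DecidableRel G.Adj] :
    ¬ (G.IsKGGraph k g ∧ G.excess k g = 4 ∧ G.HasBicyclicExcess d) := by
  classical
  rintro ⟨⟨hreg, hgirth⟩, hex, hbi⟩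
  obtain ⟨q, rfl⟩ : ∃ q, k = q + 1 := ⟨k - 1, by omega⟩
  subst hg
  obtain ⟨C, hC, hC', hadj, hreach, hdeg⟩ := hbi.exists_set
  have hq : Even (q : ℤ) := by
    rw [Int.even_coe_nat]
    grind
  have hfar : ∀ x y, G.Adj x y → (G.farFrom d x y).card < q := fun x y hxy =>
    (SimpleGraph.card_farFrom_le_of_excess hreg hgirth (e := 4) (by exact_mod_cast hex)
      hxy).trans_lt (by omega)
  have : Nonempty V := hC.to_type
  have hc := SimpleGraph.connected_of_card_farFrom_le hreg fun x y h => (hfar x y h).le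
  have hE : (G.excessGraph d).IsRegularOfDegree 2 := by
    intro v
    rw [← SimpleGraph.card_neighborSet_eq_degree, ← Nat.card_eq_fintype_card, hdeg]
  obtain ⟨a, ha⟩ := SimpleGraph.exists_nonbacktrackingPoly_eq_neg_two hc hreg hgirth hd (by omega)
    (fun u v w h => hc.dist_ne_dist_of_card_farFrom_lt hreg hgirth (by omega) hfar h w)
    (hc.dist_le_of_card_farFrom_le hreg fun x y h => (hfar x y h).le) hE hC hC' hadj hreach
  exact SimpleGraph.nonbacktrackingPoly_ne_neg_two hq a (by grind) ha
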